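/- **Theorem 3.6 (Quantum Max-flow Min-cut Theorem).** Let $G=(\tilde V,E)$ be a finite undirected graph, loops and parallel edges being allowed, and let $\tilde V = S\sqcup T\sqcup V$ where every element of $S\sqcup T$ has degree $1$; the elements of $S$ are the inputs, those of $T$ the outputs, and those of $V$ are called vertices. For $u\in S\sqcup T$ let $e(u)$ be the edge at $u$, and for $v\in V$ of degree $d_v$ let $e(v,1),\dots,e(v,d_v)$ be the edges whose ends are incident to $v$, listed in a fixed local ordering of these ends (a loop at $v$ is listed twice). Let $c:E\to\mathbb N$, $e\mapsto c_e$, be a capacity function. A tensor assignment $\mathcal T$ chooses, independently for every $v\in V$, a tensor $\mathcal T_v\in\bigotimes_{i=1}^{d_v}\mathbb C^{c_{e(v,i)}}$. Put $V_S=\bigotimes_{u\in S}\mathbb C^{c_{e(u)}}$ and $V_T=\bigotimes_{u\in T}\mathbb C^{c_{e(u)}}$, and let $\beta(G,c;\mathcal T)\in\mathrm{Hom}(V_S,V_T)$ be the linear map with matrix entries, in the standard bases, $$\langle I_T|\beta(G,c;\mathcal T)|I_S\rangle=\sum_{W}\ \prod_{v\in V}(\mathcal T_v)_{W_{e(v,1)},\dots,W_{e(v,d_v)}},$$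 where $W$ runs over all $(W_e)_{e\in E}$ with $W_e\in\{1,\dots,c_e\}$ that agree with the multi-index $I_S$ on the input edges $e(u)$, $u\in S$, and with the multi-index $I_T$ on the output edges $e(u)$, $u\in T$. The quantum max-flow $\mathrm{QMF}(G,c)$ is the maximum of $\operatorname{rank}\beta(G,c;\mathcal T)$ over all tensor assignments $\mathcal T$. An edge cut set is a set $C\subseteq E$ for which there is a partition $\tilde V=\bar S\sqcup\bar T$ with $S\subseteq\bar S$ and $T\subseteq\bar T$ such that $C$ is the set of all edges with one end in $\bar S$ and the other in $\bar T$. The quantum min-cut $\mathrm{QMC}(G,c)$ is the minimum of $\prod_{e\in C}c_e$ over all edge cut sets $C$. If there is an integer $d>0$ such that every capacity $c_e$ is of the form $d^{k}$ with $k\in\mathbb Z_{\ge 0}$ (the exponent may depend on $e$), then $$\mathrm{QMF}(G,c)=\mathrm{QMC}(G,c).$$ -/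

import Mathlib

/-- A finite undirected graph with inputs `S` and outputs `T`, together with a local ordering.

`V` is the type of (internal) vertices, `S` and `T` are the types of input and output open ends, and
`E` is the type of edges, so that the full vertex set is `V ⊕ (S ⊕ T)`. Loops and parallel edges
are allowed. Each edge `e` has the two ends `(e, false)` and `(e, true)`; the two labels only tell
the ends apart and carry no orientation. -/
structure OpenGraph (V S T E : Type*) where
  /-- The vertex or open end at which a given end of an edge sits. -/
  attach : E × Bool → V ⊕ (S ⊕ T)
  /-- The edge end that sits at a given open end. -/
  openEnd : S ⊕ T → E × Bool
  /-- Inputs and outputs have degree one: exactly one edge end sits there. -/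
  attach_eq_inr_iff : ∀ (h : E × Bool) (u : S ⊕ T), attach h = Sum.inr u ↔ h = openEnd u
  /-- The degree of a vertex; a loop counts twice. -/
  deg : V → ℕ
  /-- The local ordering of the edge ends incident to a vertex. -/
  localOrder : ∀ v : V, Fin (deg v) ≃ {h : E × Bool // attach h = Sum.inl v}

namespace OpenGraph

variable {V S T E : Type*}

/-- The edge `e(v, i)`: the `i`-th edge at the vertex `v` in the local ordering. -/
def edgeAt (G : OpenGraph V S T E) (v : V) (i : Fin (G.deg v)) : E :=
  (G.localOrder v i).1.1

/-- The input edge `e(u)` of an input `u`. -/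
def inputEdge (G : OpenGraph V S T E) (u : S) : E := (G.openEnd (Sum.inl u)).1

/-- The output edge `e(u)` of an output `u`. -/
def outputEdge (G : OpenGraph V S T E) (u : T) : E := (G.openEnd (Sum.inr u)).1

/-- Multi-indices for the input edges: the standard basis of `V_S = ⨂_{u ∈ S} ℂ^{c (e u)}`. -/
abbrev InputIndex (G : OpenGraph V S T E) (c : E → ℕ) : Type _ :=
  ∀ u : S, Fin (c (G.inputEdge u))

/-- Multi-indices for the output edges: the standard basis of `V_T = ⨂_{u ∈ T} ℂ^{c (e u)}`. -/
abbrev OutputIndex (G : OpenGraph V S T E) (c : E → ℕ) : Type _ :=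
  ∀ u : T, Fin (c (G.outputEdge u))

/-- A tensor assignment: every vertex `v` independently gets a tensor in
`ℂ^{c (e(v,1))} ⊗ ⋯ ⊗ ℂ^{c (e(v,d_v))}`, given by its components in the standard basis. -/
abbrev TensorAssignment (G : OpenGraph V S T E) (c : E → ℕ) : Type _ :=
  ∀ v : V, (∀ i : Fin (G.deg v), Fin (c (G.edgeAt v i))) → ℂ

/-- The multi-index `W` for all edges extends the input index `I` and the output index `J`. -/
abbrev Extends (G : OpenGraph V S T E) (c : E → ℕ) (W : ∀ e : E, Fin (c e))
    (I : G.InputIndex c) (J : G.OutputIndex c) : Prop :=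
  (∀ u : S, W (G.inputEdge u) = I u) ∧ (∀ u : T, W (G.outputEdge u) = J u)

/-- The linear map `β(G, c; 𝒯) : V_S → V_T` obtained by contracting the tensor network, as a
matrix in the standard bases:
`⟨J| β |I⟩ = ∑_{W extending I, J} ∏_v ⟨W|_v | 𝒯_v⟩`. -/
def contraction [Fintype V] [Fintype S] [Fintype T] [Fintype E] [DecidableEq E]
    (G : OpenGraph V S T E) (c : E → ℕ) (τ : G.TensorAssignment c) :
    Matrix (G.OutputIndex c) (G.InputIndex c) ℂ :=
  fun J I => ∑ W : (∀ e : E, Fin (c e)) with G.Extends c W I J,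
    ∏ v : V, τ v (fun i => W (G.edgeAt v i))

/-- `C` is an edge cut set: there is a partition of all vertices and open ends into a part `A`
containing all inputs and its complement containing all outputs, such that `C` is the set of the
edges with one end in `A` and the other end outside `A`. -/
def IsEdgeCut (G : OpenGraph V S T E) (C : Finset E) : Prop :=
  ∃ A : Set (V ⊕ (S ⊕ T)),
    (∀ u : S, Sum.inr (Sum.inl u) ∈ A) ∧ (∀ u : T, Sum.inr (Sum.inr u) ∉ A) ∧
    ∀ e : E, e ∈ C ↔ ∃ b : Bool, G.attach (e, b) ∈ A ∧ G.attach (e, !b) ∉ A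

/-- The quantum max-flow: the maximal rank of the contraction over all tensor assignments. -/
noncomputable def quantumMaxFlow [Fintype V] [Fintype S] [Fintype T] [Fintype E]
    [DecidableEq S] [DecidableEq E] (G : OpenGraph V S T E) (c : E → ℕ) : ℕ :=
  sSup {r : ℕ | ∃ τ : G.TensorAssignment c, r = (G.contraction c τ).rank}

/-- The quantum min-cut: the minimum over all edge cut sets of the product of the capacities. -/
noncomputable def quantumMinCut (G : OpenGraph V S T E) (c : E → ℕ) : ℕ :=
  sInf {q : ℕ | ∃ C : Finset E, G.IsEdgeCut C ∧ q = ∏ e ∈ C, c e}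

/-- The supremum in the quantum max-flow is a maximum. -/
theorem quantumMaxFlow_isGreatest [Fintype V] [Fintype S] [Fintype T] [Fintype E]
    [DecidableEq S] [DecidableEq E] (G : OpenGraph V S T E) (c : E → ℕ) :
    IsGreatest {r : ℕ | ∃ τ : G.TensorAssignment c, r = (G.contraction c τ).rank}
      (G.quantumMaxFlow c) := by
  have hb : BddAbove {r : ℕ | ∃ τ : G.TensorAssignment c, r = (G.contraction c τ).rank} := by
    refine ⟨Fintype.card (G.InputIndex c), ?_⟩
    rintro r ⟨τ, rfl⟩
    exact Matrix.rank_le_card_width _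
  exact ⟨Nat.sSup_mem ⟨_, fun _ _ => 0, rfl⟩ hb, fun r hr => le_csSup hb hr⟩

/-- The infimum in the quantum min-cut is a minimum. -/
theorem quantumMinCut_isLeast [Fintype E] (G : OpenGraph V S T E) (c : E → ℕ) :
    IsLeast {q : ℕ | ∃ C : Finset E, G.IsEdgeCut C ∧ q = ∏ e ∈ C, c e}
      (G.quantumMinCut c) := by
  classical
  refine ⟨Nat.sInf_mem ?_, fun q hq => Nat.sInf_le hq⟩
  let A : Set (V ⊕ (S ⊕ T)) := {x | ∃ u : S, x = Sum.inr (Sum.inl u)}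
  refine ⟨_, Finset.univ.filter
    (fun e => ∃ b : Bool, G.attach (e, b) ∈ A ∧ G.attach (e, !b) ∉ A), ⟨A, ?_, ?_, ?_⟩, rfl⟩
  · intro u
    exact ⟨u, rfl⟩
  · rintro u ⟨w, hw⟩
    simp at hw
  · intro e
    simp

end OpenGraph

/-!
For `≤`, the two sides of an edge cut share only the indices on the cut edges, so the contraction
factors through a space of dimension `∏ e ∈ C, c e`.

For `≥`, replace every edge of capacity `d ^ k` by `k` parallel strands of capacity `d`. By Menger's
theorem there are as many disjoint walks of strands from inputs to outputs as the minimal total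
exponent of an edge cut, say `n`. With tensors that copy base-`d` digits along these walks, any
digits entering on the walks leave on the same walks. This gives the contraction a diagonal
submatrix of size `d ^ n` whose diagonal entries count compatible multi-indices and are therefore
non-zero, so no genericity argument is needed.
-/

/-- If the points reachable from `a` all had a successor, `next` would contain an injective, hence
surjective, self-map of this finite set, and `a` would have a predecessor. -/
theorem exists_reflTransGen_forall_not {X : Type*} [Finite X] {next : X → X → Prop}
    (hnext : Relator.LeftUnique next) {a : X} (ha : ∀ x, ¬ next x a) :
    ∃ b, Relation.ReflTransGen next a b ∧ ∀ y, ¬ next b y := by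
  by_contra! hstuck
  have hsucc (x : {x // Relation.ReflTransGen next a x}) :
      ∃ y : {x // Relation.ReflTransGen next a x}, next x y :=
    let ⟨y, hy⟩ := hstuck x x.2
    ⟨⟨y, x.2.tail hy⟩, hy⟩
  choose f hf using hsucc
  have hinj : Function.Injective f := fun x y hxy =>
    Subtype.ext (hnext (hf x) (hxy ▸ hf y))
  obtain ⟨x, hx⟩ := Finite.surjective_of_injective hinj ⟨a, .refl⟩
  exact ha x (by simpa [hx] using hf x)

/-- The out-boundary of `Z` seen from `A`: the points outside `Z` that lie in `A` or are reached
from `Z` in one step. If `Z` is disjoint from `B`, every `r`-walk from `A` to `B` meets it, so these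
sets are the vertex cuts of Menger's theorem. -/
def boundaryFrom {X : Type*} (r : X → X → Prop) (A Z : Set X) : Set X :=
  (A ∪ {y | ∃ z ∈ Z, r z y}) \ Z

/-- A family, indexed by `ι`, of `r`-walks from `A` to `B` running in pairwise disjoint sets.
Disjointness is encoded by a partial colouring: the `i`-th walk stays among the points of
colour `i`. -/
structure Linking {X : Type*} (r : X → X → Prop) (A B : Set X) (ι : Type*) where
  /-- The index of the walk a point is reserved for, if any. -/
  color : X → Option ι
  /-- The first point of a walk. -/
  source : ι → X
  /-- The last point of a walk. -/
  target : ι → X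
  source_mem : ∀ i, source i ∈ A
  target_mem : ∀ i, target i ∈ B
  color_source : ∀ i, color (source i) = some i
  walk : ∀ i, Relation.ReflTransGen (fun x y => r x y ∧ color x = color y) (source i) (target i)

namespace Linking

variable {X ι : Type*} {r : X → X → Prop} {A B : Set X}

theorem eq_of_color_eq {α : Type*} (L : Linking r A B ι) (f : X → α)
    (hf : ∀ x y, r x y → L.color x = L.color y → f x = f y) (i : ι) :
    f (L.source i) = f (L.target i) := by
  have h := (L.walk i).lift (p := Eq) f fun x y hxy => hf x y hxy.1 hxy.2
  rwa [Relation.reflTransGen_eq_self] at h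

theorem color_target (L : Linking r A B ι) (i : ι) : L.color (L.target i) = some i :=
  (L.eq_of_color_eq L.color (fun _ _ _ h => h) i).symm.trans (L.color_source i)

/-- The bipartite graph whose perfect matchings encode linkings: every point passes to a successor,
stays idle, or, in `B`, closes up a walk through one of the additional points `ι`, which re-enter
at `A`. -/
inductive Step (r : X → X → Prop) (A B : Set X) (ι : Type*) : X ⊕ ι → X ⊕ ι → Prop
  | idle (x : X) : Step r A B ι (.inl x) (.inl x)
  | pass {x y : X} (h : r x y) : Step r A B ι (.inl x) (.inl y)
  | enter {a : X} (ha : a ∈ A) (i : ι) : Step r A B ι (.inr i) (.inl a)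
  | leave {b : X} (hb : b ∈ B) (i : ι) : Step r A B ι (.inl b) (.inr i)

open Classical in
theorem card_le_card_step [Fintype X] [Fintype ι]
    (h : ∀ Z : Set X, Disjoint Z B → Fintype.card ι ≤ (boundaryFrom r A Z).ncard)
    (s : Finset (X ⊕ ι)) :
    s.card ≤ (Finset.univ.filter fun q => ∃ p ∈ s, Step r A B ι p q).card := by
  set N := Finset.univ.filter fun q => ∃ p ∈ s, Step r A B ι p q
  have mem_N {p q} (hp : p ∈ s) (hpq : Step r A B ι p q) : q ∈ N :=
    (Finset.mem_filter_univ q).2 ⟨p, hp, hpq⟩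
  have left_subset : s.toLeft ⊆ N.toLeft := fun x hx =>
    Finset.mem_toLeft.2 (mem_N (Finset.mem_toLeft.1 hx) (.idle x))
  rw [← s.card_toLeft_add_card_toRight, ← N.card_toLeft_add_card_toRight]
  by_cases hB : ∃ b ∈ s.toLeft, b ∈ B
  · obtain ⟨b, hb, hbB⟩ := hB
    have right_subset : s.toRight ⊆ N.toRight := fun i _ =>
      Finset.mem_toRight.2 (mem_N (Finset.mem_toLeft.1 hb) (.leave hbB i))
    exact add_le_add (Finset.card_le_card left_subset) (Finset.card_le_card right_subset)
  rcases s.toRight.eq_empty_or_nonempty with hempty | ⟨i, hi⟩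
  · rw [hempty, Finset.card_empty]
    exact add_le_add (Finset.card_le_card left_subset) (Nat.zero_le _)
  have disjoint_B : Disjoint (s.toLeft : Set X) B :=
    Set.disjoint_left.2 fun b hb hbB => hB ⟨b, hb, hbB⟩
  have boundary_subset : boundaryFrom r A s.toLeft ⊆ N.toLeft := by
    rintro y ⟨hA | ⟨z, hz, hzy⟩, -⟩
    · exact Finset.mem_toLeft.2 (mem_N (Finset.mem_toRight.1 hi) (.enter hA i))
    · exact Finset.mem_toLeft.2 (mem_N (Finset.mem_toLeft.1 hz) (.pass hzy))
  calc s.toLeft.card + s.toRight.card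
      ≤ (s.toLeft : Set X).ncard + (boundaryFrom r A s.toLeft).ncard := by
        rw [Set.ncard_coe_finset]
        gcongr
        exact s.toRight.card_le_univ.trans (h _ disjoint_B)
    _ = ((s.toLeft : Set X) ∪ boundaryFrom r A s.toLeft).ncard :=
        (Set.ncard_union_eq Set.disjoint_sdiff_right).symm
    _ ≤ (N.toLeft : Set X).ncard :=
        Set.ncard_le_ncard (Set.union_subset (by exact_mod_cast left_subset) boundary_subset)
    _ ≤ N.toLeft.card + N.toRight.card := by
        rw [Set.ncard_coe_finset]
        exact Nat.le_add_right _ _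

theorem nonempty_of_successor [Finite X] {next : X → X → Prop} {start : ι → X}
    (next_leftUnique : Relator.LeftUnique next)
    (next_rel : ∀ x y, next x y → x = y ∨ r x y)
    (mem_of_not_next : ∀ x, (∀ y, ¬ next x y) → x ∈ B)
    (start_injective : Function.Injective start) (start_mem : ∀ i, start i ∈ A)
    (not_next_start : ∀ x i, ¬ next x (start i)) :
    Nonempty (Linking r A B ι) := by
  classical
  have index_unique {i j x} (hi : Relation.ReflTransGen next (start i) x)
      (hj : Relation.ReflTransGen next (start j) x) : i = j := by
    have eq_of_reach {i j} (h : Relation.ReflTransGen next (start i) (start j)) : i = j :=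
      h.cases_tail.elim (fun h => start_injective h.symm)
        fun ⟨c, _, hc⟩ => absurd hc (not_next_start c j)
    rcases Relation.ReflTransGen.total_of_right_unique (r := Function.swap next)
      next_leftUnique.flip (Relation.reflTransGen_swap.2 hi) (Relation.reflTransGen_swap.2 hj)
      with h | h
    · exact (eq_of_reach (Relation.reflTransGen_swap.1 h)).symm
    · exact eq_of_reach (Relation.reflTransGen_swap.1 h)
  let color (x : X) : Option ι :=
    if h : ∃ i, Relation.ReflTransGen next (start i) x then some h.choose else none
  have color_eq {i x} (hx : Relation.ReflTransGen next (start i) x) : color x = some i := by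
    have h : ∃ i, Relation.ReflTransGen next (start i) x := ⟨i, hx⟩
    rw [show color x = some h.choose from dif_pos h, index_unique h.choose_spec hx]
  have colored_walk {i x} (hx : Relation.ReflTransGen next (start i) x) :
      Relation.ReflTransGen (fun x y => r x y ∧ color x = color y) (start i) x := by
    induction hx with
    | refl => exact .refl
    | tail hx hxy ih =>
      rcases next_rel _ _ hxy with rfl | hr
      · exact ih
      · exact ih.tail ⟨hr, (color_eq hx).trans (color_eq (hx.tail hxy)).symm⟩
  choose finish hreach hfinish using fun i =>
    exists_reflTransGen_forall_not next_leftUnique fun x => not_next_start x i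
  exact ⟨⟨color, start, finish, start_mem, fun i => mem_of_not_next _ (hfinish i),
    fun i => color_eq .refl, fun i => colored_walk (hreach i)⟩⟩

/-- Menger's theorem: Hall's marriage theorem for `Step` yields an injective successor function,
whose orbits from the entry points in `A` are the required walks. -/
theorem nonempty_of_card_le_ncard_boundaryFrom [Finite X] [Fintype ι]
    (h : ∀ Z : Set X, Disjoint Z B → Fintype.card ι ≤ (boundaryFrom r A Z).ncard) :
    Nonempty (Linking r A B ι) := by
  classical
  have := Fintype.ofFinite X
  obtain ⟨σ, hσ, hstep⟩ :=
    (Fintype.all_card_le_filter_rel_iff_exists_injective (Step r A B ι)).1 (card_le_card_step h)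
  have hentry (i : ι) : ∃ a ∈ A, σ (.inr i) = .inl a := by
    generalize hq : σ (.inr i) = q
    cases hq ▸ hstep (.inr i) with
    | enter ha => exact ⟨_, ha, rfl⟩
  choose start hstart hσ_start using hentry
  refine nonempty_of_successor (next := fun x y => σ (.inl x) = .inl y) (start := start)
    (fun x y z hx hy => Sum.inl_injective (hσ (hx.trans hy.symm))) (fun x y hxy => ?_)
    (fun x hx => ?_) (fun i j hij => ?_) hstart fun x i hx => ?_
  · cases hxy ▸ hstep (.inl x) with
    | idle => exact .inl rfl
    | pass h => exact .inr h
  · generalize hq : σ (.inl x) = q at hx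
    cases hq ▸ hstep (.inl x) with
    | idle => exact absurd rfl (hx x)
    | pass => exact absurd rfl (hx _)
    | leave hb => exact hb
  · exact Sum.inr_injective (hσ (by rw [hσ_start, hσ_start, hij]))
  · exact absurd (hσ (hx.trans (hσ_start i).symm)) Sum.inl_ne_inr

end Linking

theorem rank_of_sum_mul_le_of_dependsOn {ι m n R : Type*} {Y : ι → Type*} [Fintype ι]
    [DecidableEq ι] [∀ i, Fintype (Y i)] [Fintype n] [CommSemiring R] [StrongRankCondition R]
    {P Q : Finset ι} {f : n → (∀ i, Y i) → R} {g : m → (∀ i, Y i) → R}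
    (hf : ∀ a, DependsOn (f a) P) (hg : ∀ b, DependsOn (g b) Q) :
    (Matrix.of fun b a => ∑ W, g b W * f a W).rank ≤ ∏ i ∈ P ∩ Q, Fintype.card (Y i) := by
  classical
  let split := Equiv.piEquivPiSubtypeProd (· ∈ P) Y
  let overlap (p : ∀ i : {i // i ∈ P}, Y i) (i : {i // i ∈ P ∩ Q}) : Y i :=
    p ⟨i, (Finset.mem_inter.1 i.2).1⟩
  let gSum (b : m) (p : ∀ i : {i // i ∈ P}, Y i) : R := ∑ U, g b (split.symm (p, U))
  have gSum_factors (b : m) : (gSum b).FactorsThrough overlap := by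
    refine fun p p' hpp' => Finset.sum_congr rfl fun U _ => hg b fun i hi => ?_
    by_cases hP : i ∈ P
    · simpa [split, Equiv.piEquivPiSubtypeProd, hP] using
        congrFun hpp' ⟨i, Finset.mem_inter.2 ⟨hP, hi⟩⟩
    · simp [split, Equiv.piEquivPiSubtypeProd, hP]
  choose f' hf' using fun a => dependsOn_iff_exists_comp.1 (hf a)
  choose g' hg' using fun b => (Function.factorsThrough_iff _).1 (gSum_factors b)
  have hfactor : (Matrix.of fun b a => ∑ W, g b W * f a W) =
      (Matrix.of g').submatrix id overlap * Matrix.of fun p a => f' a p := by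
    ext b a
    have hf_split (p U) : f a (split.symm (p, U)) = f' a p := by
      rw [hf' a, Function.comp_apply]
      exact congrArg (f' a) (congrArg Prod.fst (split.apply_symm_apply (p, U)))
    simp only [Matrix.mul_apply, Matrix.of_apply, Matrix.submatrix_apply, id]
    rw [← split.symm.sum_comp, Fintype.sum_prod_type]
    refine Finset.sum_congr rfl fun p _ => ?_
    simp only [hf_split, ← Finset.sum_mul]
    exact congrArg (· * f' a p) (congrFun (hg' b) p)
  calc (Matrix.of fun b a => ∑ W, g b W * f a W).rank
      ≤ ((Matrix.of g').submatrix id overlap).rank := hfactor ▸ Matrix.rank_mul_le_left _ _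
    _ ≤ (Matrix.of g').rank := Matrix.rank_submatrix_le _ _ _
    _ ≤ Fintype.card (∀ i : {i // i ∈ P ∩ Q}, Y i) := Matrix.rank_le_card_width _
    _ = ∏ i ∈ P ∩ Q, Fintype.card (Y i) := by
        rw [Fintype.card_pi, Finset.prod_coe_sort _ fun i => Fintype.card (Y i)]

theorem card_le_rank_of_submatrix_eq_diagonal {ι m n K : Type*} [Fintype ι] [DecidableEq ι]
    [Fintype n] [Field K] {M : Matrix m n K} {row : ι → m} {col : ι → n} {w : ι → K}
    (hM : M.submatrix row col = Matrix.diagonal w) (hw : ∀ i, w i ≠ 0) :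
    Fintype.card ι ≤ M.rank := by
  classical
  calc Fintype.card ι = (Matrix.diagonal w).rank := by simp [Matrix.rank_diagonal, hw]
    _ ≤ M.rank := hM ▸ Matrix.rank_submatrix_le _ _ _

namespace OpenGraph

variable {V S T E : Type*}

theorem attach_openEnd (G : OpenGraph V S T E) (u : S ⊕ T) :
    G.attach (G.openEnd u) = Sum.inr u :=
  (G.attach_eq_inr_iff _ _).2 rfl

theorem exists_edgeAt_eq_iff (G : OpenGraph V S T E) {v : V} {e : E} :
    (∃ i, G.edgeAt v i = e) ↔ ∃ b, G.attach (e, b) = Sum.inl v := by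
  constructor
  · rintro ⟨i, rfl⟩
    exact ⟨_, (G.localOrder v i).2⟩
  · rintro ⟨b, h⟩
    exact ⟨(G.localOrder v).symm ⟨(e, b), h⟩, by simp [edgeAt]⟩

section EdgeCut

variable [Fintype E]

open Classical in
/-- The edges with at least one end in `A`. The edge cut given by `A` consists of the edges
meeting both `A` and its complement. -/
noncomputable def edgesMeeting (G : OpenGraph V S T E) (A : Set (V ⊕ (S ⊕ T))) : Finset E :=
  {e | ∃ b, G.attach (e, b) ∈ A}

theorem mem_edgesMeeting {G : OpenGraph V S T E} {A : Set (V ⊕ (S ⊕ T))} {e : E} :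
    e ∈ G.edgesMeeting A ↔ ∃ b, G.attach (e, b) ∈ A := by
  simp [edgesMeeting]

theorem edgeAt_mem_edgesMeeting (G : OpenGraph V S T E) {A : Set (V ⊕ (S ⊕ T))} {v : V}
    (hv : Sum.inl v ∈ A) (i : Fin (G.deg v)) : G.edgeAt v i ∈ G.edgesMeeting A :=
  mem_edgesMeeting.2 <| (G.exists_edgeAt_eq_iff.1 ⟨i, rfl⟩).imp fun _ h => Set.mem_of_eq_of_mem h hv

theorem fst_openEnd_mem_edgesMeeting (G : OpenGraph V S T E) {A : Set (V ⊕ (S ⊕ T))} {u : S ⊕ T}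
    (hu : Sum.inr u ∈ A) : (G.openEnd u).1 ∈ G.edgesMeeting A :=
  mem_edgesMeeting.2 ⟨(G.openEnd u).2, (G.attach_openEnd u).symm ▸ hu⟩

theorem isEdgeCut_iff [DecidableEq E] (G : OpenGraph V S T E) {C : Finset E} :
    G.IsEdgeCut C ↔ ∃ A : Set (V ⊕ (S ⊕ T)),
      (∀ u, Sum.inr (Sum.inl u) ∈ A) ∧ (∀ u, Sum.inr (Sum.inr u) ∉ A) ∧
        C = G.edgesMeeting A ∩ G.edgesMeeting Aᶜ := by
  refine exists_congr fun A => and_congr_right' <| and_congr_right' ?_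
  simp only [Finset.ext_iff, Finset.mem_inter, mem_edgesMeeting, Set.mem_compl_iff,
    Bool.exists_bool, Bool.not_false, Bool.not_true]
  exact forall_congr' fun e => by tauto

end EdgeCut

section UpperBound

variable [Fintype V] {c : E → ℕ}

open Classical in
/-- The factor that a set `A` contributes to a summand of a contraction: the product of the tensor
entries at the vertices in `A`, or `0` if `W` disagrees with the multi-index `I` on one of the
prescribed edges. -/
noncomputable def amplitude {U : Type*} (G : OpenGraph V S T E) (τ : G.TensorAssignment c)
    (A : Set (V ⊕ (S ⊕ T))) (edge : U → E) (I : ∀ u, Fin (c (edge u))) (W : ∀ e, Fin (c e)) : ℂ :=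
  if ∀ u, W (edge u) = I u then
    ∏ v with Sum.inl v ∈ A, τ v (fun i => W (G.edgeAt v i)) else 0

theorem dependsOn_amplitude [Fintype E] {U : Type*} (G : OpenGraph V S T E)
    (τ : G.TensorAssignment c) {A : Set (V ⊕ (S ⊕ T))} {edge : U → E}
    (hA : ∀ u, edge u ∈ G.edgesMeeting A) (I : ∀ u, Fin (c (edge u))) :
    DependsOn (G.amplitude τ A edge I) (G.edgesMeeting A) := by
  classical
  intro W W' h
  have hedge (u : U) : W (edge u) = W' (edge u) := h _ (hA u)
  have hprod : ∏ v with Sum.inl v ∈ A, τ v (fun i => W (G.edgeAt v i)) =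
      ∏ v with Sum.inl v ∈ A, τ v (fun i => W' (G.edgeAt v i)) := by
    refine Finset.prod_congr rfl fun v hv => congrArg (τ v) (funext fun i => ?_)
    exact h _ (G.edgeAt_mem_edgesMeeting ((Finset.mem_filter_univ v).1 hv) i)
  unfold amplitude
  simp only [hedge, hprod]

variable [Fintype S] [Fintype T] [Fintype E] [DecidableEq E]

theorem contraction_eq_sum_amplitude_mul_amplitude (G : OpenGraph V S T E)
    (τ : G.TensorAssignment c) (A : Set (V ⊕ (S ⊕ T))) :
    G.contraction c τ =
      Matrix.of fun J I =>
        ∑ W, G.amplitude τ Aᶜ G.outputEdge J W * G.amplitude τ A G.inputEdge I W := by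
  classical
  ext J I
  rw [contraction, Matrix.of_apply, Finset.sum_filter]
  refine Finset.sum_congr (by congr!) fun W _ => ?_
  simp only [amplitude, ite_zero_mul_ite_zero, Set.mem_compl_iff]
  rw [mul_comm, Finset.prod_filter_mul_prod_filter_not]
  congr 1
  exact propext and_comm

theorem rank_contraction_le_of_isEdgeCut [DecidableEq S] (G : OpenGraph V S T E)
    (τ : G.TensorAssignment c) {C : Finset E} (hC : G.IsEdgeCut C) :
    (G.contraction c τ).rank ≤ ∏ e ∈ C, c e := by
  obtain ⟨A, hS, hT, rfl⟩ := G.isEdgeCut_iff.1 hC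
  rw [G.contraction_eq_sum_amplitude_mul_amplitude τ A]
  simpa using rank_of_sum_mul_le_of_dependsOn
    (G.dependsOn_amplitude (edge := G.inputEdge) τ fun u => G.fst_openEnd_mem_edgesMeeting (hS u))
    (G.dependsOn_amplitude (edge := G.outputEdge) τ fun u => G.fst_openEnd_mem_edgesMeeting (hT u))

end UpperBound

section Strand

/-- Edge `e` regarded as a cable of `k e` parallel strands. When `e` has capacity `d ^ k e`, a
strand carries one base-`d` digit of the index at `e`. -/
abbrev Strand (k : E → ℕ) : Type _ := Σ e, Fin (k e)

variable {k : E → ℕ}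

/-- Two strands are adjacent if their edges share a vertex; open ends do not count. -/
def StrandAdj (G : OpenGraph V S T E) (x y : Strand k) : Prop :=
  ∃ v i j, G.edgeAt v i = x.1 ∧ G.edgeAt v j = y.1

/-- The strands of the input edges. -/
def inputStrands (G : OpenGraph V S T E) (k : E → ℕ) : Set (Strand k) :=
  {x | ∃ u, G.inputEdge u = x.1}

/-- The strands of the output edges. -/
def outputStrands (G : OpenGraph V S T E) (k : E → ℕ) : Set (Strand k) :=
  {x | ∃ u, G.outputEdge u = x.1}

/-- The side of an edge cut spanned by a set `Z` of strands: the inputs and the vertices that `Z`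
touches. -/
def sideOf (G : OpenGraph V S T E) (Z : Set (Strand k)) : Set (V ⊕ (S ⊕ T)) :=
  {p | (∃ u, p = Sum.inr (Sum.inl u)) ∨ ∃ v, p = Sum.inl v ∧ ∃ z ∈ Z, ∃ i, G.edgeAt v i = z.1}

theorem attach_mem_sideOf (G : OpenGraph V S T E) {Z : Set (Strand k)}
    (hZ : Disjoint Z (G.outputStrands k)) {z : Strand k} (hz : z ∈ Z) (b : Bool) :
    G.attach (z.1, b) ∈ G.sideOf Z := by
  rcases hp : G.attach (z.1, b) with v | u | u
  · exact Or.inr ⟨v, rfl, z, hz, G.exists_edgeAt_eq_iff.2 ⟨b, hp⟩⟩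
  · exact Or.inl ⟨u, rfl⟩
  · refine absurd ⟨u, ?_⟩ (Set.disjoint_left.1 hZ hz)
    rw [outputEdge, ← (G.attach_eq_inr_iff _ _).1 hp]

theorem mem_inputStrands_or_exists_strandAdj (G : OpenGraph V S T E) {Z : Set (Strand k)}
    {x : Strand k} {b : Bool} (hx : G.attach (x.1, b) ∈ G.sideOf Z) :
    x ∈ G.inputStrands k ∨ ∃ z ∈ Z, G.StrandAdj z x := by
  rcases hx with ⟨u, hu⟩ | ⟨v, hv, z, hz, i, hi⟩
  · exact Or.inl ⟨u, by rw [inputEdge, ← (G.attach_eq_inr_iff _ _).1 hu]⟩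
  · obtain ⟨j, hj⟩ := G.exists_edgeAt_eq_iff.2 ⟨b, hv⟩
    exact Or.inr ⟨z, hz, v, i, j, hi, hj⟩

theorem isEdgeCut_sideOf [Fintype E] [DecidableEq E] (G : OpenGraph V S T E) (Z : Set (Strand k)) :
    G.IsEdgeCut (G.edgesMeeting (G.sideOf Z) ∩ G.edgesMeeting (G.sideOf Z)ᶜ) :=
  G.isEdgeCut_iff.2 ⟨G.sideOf Z, fun u => Or.inl ⟨u, rfl⟩, fun u => by simp [sideOf], rfl⟩

theorem sum_cut_sideOf_le_ncard_boundaryFrom [Fintype E] [DecidableEq E] (G : OpenGraph V S T E)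
    {Z : Set (Strand k)} (hZ : Disjoint Z (G.outputStrands k)) :
    ∑ e ∈ G.edgesMeeting (G.sideOf Z) ∩ G.edgesMeeting (G.sideOf Z)ᶜ, k e ≤
      (boundaryFrom G.StrandAdj (G.inputStrands k) Z).ncard := by
  set C := G.edgesMeeting (G.sideOf Z) ∩ G.edgesMeeting (G.sideOf Z)ᶜ
  let cutStrands : Finset (Strand k) := C.sigma fun _ => Finset.univ
  have hsub : (cutStrands : Set (Strand k)) ⊆
      boundaryFrom G.StrandAdj (G.inputStrands k) Z := by
    intro x hx
    obtain ⟨hin, hout⟩ := Finset.mem_inter.1 (Finset.mem_sigma.1 hx).1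
    obtain ⟨b, hb⟩ := mem_edgesMeeting.1 hin
    obtain ⟨b', hb'⟩ := mem_edgesMeeting.1 hout
    exact ⟨G.mem_inputStrands_or_exists_strandAdj hb,
      fun hxZ => hb' (G.attach_mem_sideOf hZ hxZ b')⟩
  calc ∑ e ∈ C, k e = (cutStrands : Set (Strand k)).ncard := by
        rw [Set.ncard_coe_finset, Finset.card_sigma]
        simp only [Finset.card_univ, Fintype.card_fin]
    _ ≤ _ := Set.ncard_le_ncard hsub

theorem nonempty_strand_linking [Finite E] {ι : Type*} [Fintype ι] (G : OpenGraph V S T E)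
    (h : ∀ C, G.IsEdgeCut C → Fintype.card ι ≤ ∑ e ∈ C, k e) :
    Nonempty (Linking G.StrandAdj (G.inputStrands k) (G.outputStrands k) ι) := by
  classical
  have := Fintype.ofFinite E
  exact Linking.nonempty_of_card_le_ncard_boundaryFrom fun Z hZ =>
    (h _ (G.isEdgeCut_sideOf Z)).trans (G.sum_cut_sideOf_le_ncard_boundaryFrom hZ)

end Strand

section LowerBound

variable {k : E → ℕ} {d : ℕ}

/-- A multi-index for capacities `d ^ k e` amounts to one base-`d` digit per strand. -/
def digits : (∀ e, Fin (d ^ k e)) ≃ (Strand k → Fin d) :=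
  (Equiv.piCongrRight fun _ => finFunctionFinEquiv.symm).trans (Equiv.piCurry _).symm

theorem digits_congr {W W' : ∀ e, Fin (d ^ k e)} {x : Strand k} (h : W x.1 = W' x.1) :
    digits W x = digits W' x :=
  congrArg (finFunctionFinEquiv.symm · x.2) h

variable {K ι : Type*}

/-- Adjacent strands of the same colour carry the same digit. -/
def RespectsColoring (G : OpenGraph V S T E) (κ : Strand k → K) (W : ∀ e, Fin (d ^ k e)) : Prop :=
  ∀ x y, G.StrandAdj x y → κ x = κ y → digits W x = digits W y

open Classical in
/-- The tensor assignment that copies digits along colour classes: at every vertex, it is the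
indicator of the multi-indices in which strands of the same colour carry the same digit. -/
noncomputable def coloringTensor (G : OpenGraph V S T E) (κ : Strand k → K) :
    G.TensorAssignment fun e => d ^ k e :=
  fun v w => if ∀ i j s t, κ ⟨G.edgeAt v i, s⟩ = κ ⟨G.edgeAt v j, t⟩ →
    finFunctionFinEquiv.symm (w i) s = finFunctionFinEquiv.symm (w j) t then 1 else 0

theorem respectsColoring_iff (G : OpenGraph V S T E) (κ : Strand k → K)
    (W : ∀ e, Fin (d ^ k e)) :
    G.RespectsColoring κ W ↔ ∀ v i j s t, κ ⟨G.edgeAt v i, s⟩ = κ ⟨G.edgeAt v j, t⟩ →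
      digits W ⟨G.edgeAt v i, s⟩ = digits W ⟨G.edgeAt v j, t⟩ := by
  constructor
  · exact fun h v i j s t => h _ _ ⟨v, i, j, rfl, rfl⟩
  · rintro h ⟨_, s⟩ ⟨_, t⟩ ⟨v, i, j, rfl, rfl⟩
    exact h v i j s t

theorem contraction_coloringTensor [Fintype V] [Fintype S] [Fintype T] [Fintype E]
    [DecidableEq E] (G : OpenGraph V S T E) (κ : Strand k → K)
    [DecidablePred fun W : ∀ e, Fin (d ^ k e) => G.RespectsColoring κ W]
    (I : G.InputIndex fun e => d ^ k e) (J : G.OutputIndex fun e => d ^ k e) :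
    G.contraction _ (G.coloringTensor κ) J I =
      (Finset.univ.filter fun W => G.Extends _ W I J ∧ G.RespectsColoring κ W).card := by
  have hprod (W : ∀ e, Fin (d ^ k e)) :
      ∏ v, G.coloringTensor κ v (fun i => W (G.edgeAt v i)) =
        if G.RespectsColoring κ W then 1 else 0 := by
    simp only [coloringTensor, Finset.prod_ite_zero, Finset.mem_univ, forall_const,
      Finset.prod_const_one]
    congr 1
    exact propext ⟨fun h => (G.respectsColoring_iff κ W).2 fun v => h v (Finset.mem_univ v),
      fun h v _ => (G.respectsColoring_iff κ W).1 h v⟩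
  simp only [contraction, hprod, Finset.sum_boole, Finset.filter_filter]

/-- The multi-index in which the strands of the `i`-th walk carry the digit `y i`. The strands
without colour carry `0`. -/
def walkIndex [NeZero d] {r : Strand k → Strand k → Prop} {A B : Set (Strand k)}
    (L : Linking r A B ι) (y : ι → Fin d) : ∀ e, Fin (d ^ k e) :=
  digits.symm fun x => (L.color x).elim 0 y

section walkIndex

variable [NeZero d]

theorem digits_walkIndex {r : Strand k → Strand k → Prop} {A B : Set (Strand k)}
    (L : Linking r A B ι) (y : ι → Fin d) {x : Strand k} {i : ι} (hx : L.color x = some i) :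
    digits (walkIndex L y) x = y i := by
  rw [walkIndex, Equiv.apply_symm_apply, hx, Option.elim_some]

variable (G : OpenGraph V S T E)
  (L : Linking G.StrandAdj (G.inputStrands k) (G.outputStrands k) ι)

theorem respectsColoring_walkIndex (y : ι → Fin d) :
    G.RespectsColoring L.color (walkIndex L y) := by
  intro x x' _ hκ
  simp only [walkIndex, Equiv.apply_symm_apply, hκ]

theorem eq_of_extends_walkIndex {y z : ι → Fin d} {W : ∀ e, Fin (d ^ k e)}
    (hext : G.Extends _ W (fun u => walkIndex L y (G.inputEdge u))
      fun u => walkIndex L z (G.outputEdge u))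
    (hW : G.RespectsColoring L.color W) : y = z := by
  funext i
  obtain ⟨u, hu⟩ := L.source_mem i
  obtain ⟨u', hu'⟩ := L.target_mem i
  calc y i = digits (walkIndex L y) (L.source i) := (digits_walkIndex L y (L.color_source i)).symm
    _ = digits W (L.source i) := digits_congr (hu ▸ (hext.1 u).symm)
    _ = digits W (L.target i) := L.eq_of_color_eq (digits W) hW i
    _ = digits (walkIndex L z) (L.target i) := digits_congr (hu' ▸ hext.2 u')
    _ = z i := digits_walkIndex L z (L.color_target i)

variable [Fintype V] [Fintype S] [Fintype T] [Fintype E] [DecidableEq E]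

theorem contraction_walkIndex_eq_zero {y z : ι → Fin d} (hyz : y ≠ z) :
    G.contraction _ (G.coloringTensor L.color) (fun u => walkIndex L z (G.outputEdge u))
      (fun u => walkIndex L y (G.inputEdge u)) = 0 := by
  classical
  rw [G.contraction_coloringTensor, Nat.cast_eq_zero, Finset.card_eq_zero,
    Finset.filter_eq_empty_iff]
  exact fun W _ hW => hyz (G.eq_of_extends_walkIndex L hW.1 hW.2)

theorem contraction_walkIndex_ne_zero (y : ι → Fin d) :
    G.contraction _ (G.coloringTensor L.color) (fun u => walkIndex L y (G.outputEdge u))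
      (fun u => walkIndex L y (G.inputEdge u)) ≠ 0 := by
  classical
  rw [G.contraction_coloringTensor, Nat.cast_ne_zero, Finset.card_ne_zero]
  exact ⟨walkIndex L y, (Finset.mem_filter_univ _).2
    ⟨⟨fun _ => rfl, fun _ => rfl⟩, G.respectsColoring_walkIndex L y⟩⟩

theorem pow_card_le_rank_contraction [Fintype ι] [DecidableEq S] :
    d ^ Fintype.card ι ≤ (G.contraction _ (G.coloringTensor (d := d) L.color)).rank := by
  classical
  have hdiag : (G.contraction _ (G.coloringTensor (d := d) L.color)).submatrix
      (fun y u => walkIndex L y (G.outputEdge u)) (fun y u => walkIndex L y (G.inputEdge u)) =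
      Matrix.diagonal fun y => G.contraction _ (G.coloringTensor L.color)
        (fun u => walkIndex L y (G.outputEdge u)) (fun u => walkIndex L y (G.inputEdge u)) := by
    ext z y
    rcases eq_or_ne z y with rfl | hzy
    · rw [Matrix.submatrix_apply, Matrix.diagonal_apply_eq]
    · rw [Matrix.submatrix_apply, Matrix.diagonal_apply_ne _ hzy,
        G.contraction_walkIndex_eq_zero L hzy.symm]
  simpa using card_le_rank_of_submatrix_eq_diagonal hdiag (G.contraction_walkIndex_ne_zero L)

end walkIndex

end LowerBound

end OpenGraph

theorem theorem3p6 {V S T E : Type*} [Fintype V] [Fintype S] [Fintype T] [Fintype E]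
    [DecidableEq S] [DecidableEq E]
    (G : OpenGraph V S T E) (c : E → ℕ)
    (hc : ∃ d : ℕ, 0 < d ∧ ∀ e : E, ∃ k : ℕ, c e = d ^ k) :
    G.quantumMaxFlow c = G.quantumMinCut c := by
  obtain ⟨d, hd, hpow⟩ := hc
  have : NeZero d := ⟨hd.ne'⟩
  choose k hk using hpow
  obtain rfl : c = fun e => d ^ k e := funext hk
  have hflow := G.quantumMaxFlow_isGreatest fun e => d ^ k e
  have hcut := G.quantumMinCut_isLeast fun e => d ^ k e
  obtain ⟨C₀, hC₀, hC₀_eq⟩ := hcut.1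
  apply le_antisymm
  · obtain ⟨τ, hτ⟩ := hflow.1
    rw [hτ, hC₀_eq]
    exact G.rank_contraction_le_of_isEdgeCut τ hC₀
  · -- For `d = 1` only the exponents tell the cuts apart, so the total exponent is minimised.
    obtain ⟨C, hC, hmin⟩ := exists_minimalFor_of_wellFoundedLT G.IsEdgeCut
      (fun C => ∑ e ∈ C, k e) ⟨C₀, hC₀⟩
    obtain ⟨L⟩ := G.nonempty_strand_linking (ι := Fin (∑ e ∈ C, k e)) fun C' hC' => by
      simpa using (le_total _ _).elim id (hmin hC')
    calc G.quantumMinCut (fun e => d ^ k e) ≤ ∏ e ∈ C, d ^ k e := hcut.2 ⟨C, hC, rfl⟩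
      _ = d ^ Fintype.card (Fin (∑ e ∈ C, k e)) := by
          rw [Finset.prod_pow_eq_pow_sum, Fintype.card_fin]
      _ ≤ (G.contraction _ (G.coloringTensor L.color)).rank := G.pow_card_le_rank_contraction L
      _ ≤ G.quantumMaxFlow fun e => d ^ k e := hflow.2 ⟨_, rfl⟩
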